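/- Let $n\ge 1$. A word $\pi$ over the positive integers contains a word $\sigma=\sigma_1\cdots\sigma_k$ (a pattern) if there are indices $i_1<\dots<i_k$ such that, for all $r,s$, $\pi_{i_r}<\pi_{i_s}$ if and only if $\sigma_r<\sigma_s$, and $\pi_{i_r}=\pi_{i_s}$ if and only if $\sigma_r=\sigma_s$; otherwise $\pi$ avoids $\sigma$. A nonnesting permutation of the multiset $\{1,1,2,2,\dots,n,n\}$ is an arrangement of this multiset into a word that avoids the patterns $1221$ and $2112$. Then the number of nonnesting permutations of $\{1,1,2,2,\dots,n,n\}$ that avoid both patterns $1322$ and $2231$ is $$\binom{2n}{n}-2^{n-1}.$$ -/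

import Mathlib

namespace NonnestingPerm

/-- The word `π` contains the pattern `σ`: there are indices `i₁ < ⋯ < i_k` of `π`
(`k` the length of `σ`) such that the subsequence of `π` at these indices is in the same relative
order as `σ`, for strict inequalities as well as for equalities. -/
def Contains (π σ : List ℕ) : Prop :=
  ∃ i : Fin σ.length → Fin π.length, StrictMono i ∧
    ∀ r s : Fin σ.length,
      (π.get (i r) < π.get (i s) ↔ σ.get r < σ.get s) ∧
      (π.get (i r) = π.get (i s) ↔ σ.get r = σ.get s)

/-- The word `π` avoids the pattern `σ`. -/
def Avoids (π σ : List ℕ) : Prop := ¬ Contains π σ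

/-- The multiset `{1,1,2,2,…,n,n}`. -/
def doubled (n : ℕ) : Multiset ℕ := 2 • (Finset.Icc 1 n).val

/-- The nonnesting permutations of `{1,1,2,2,…,n,n}`: arrangements of this multiset into a word
that avoids the patterns `1221` and `2112`. -/
def nonnesting (n : ℕ) : Set (List ℕ) :=
  {π | (π : Multiset ℕ) = doubled n ∧ Avoids π [1, 2, 2, 1] ∧ Avoids π [2, 1, 1, 2]}

/-- The nonnesting permutations of `{1,1,2,2,…,n,n}` that avoid every pattern in `Λ`. -/
def nonnestingAvoiding (n : ℕ) (Λ : Set (List ℕ)) : Set (List ℕ) :=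
  {π | π ∈ nonnesting n ∧ ∀ σ ∈ Λ, Avoids π σ}

end NonnestingPerm

/-!
The words are generated by inserting their letters in increasing order.

In a nonnesting word avoiding `1322` and `2231` the largest letter is the first or the last letter
(`Good.exists_eq_cons_or_reverse`), and reversal of words preserves all the conditions. So a word
with letters up to `n + 1` arises from one with letters up to `n` by putting one copy of `n + 1` at
the front and the other one after some prefix `u`, or by the mirror image of this operation. The
forbidden patterns that use `n + 1` are absent exactly when `u` has distinct letters, each larger
than every letter not in `u` (`Good.cons_append_cons`, `Good.admissible_of_cons`). Call the length
of such a prefix a slot. After an insertion at the front in slot `k`, the slots for the front are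
`0` and all `j + 1` with `j ≤ k` an old slot (`Good.mem_slots_extend`), and the only slot for the
back is `0`, unless `k = n` (`Good.slots_reverse_extend`). Slot `n` is available exactly when all
first copies precede all second copies.

Up to reversal, the future of a word thus depends on one number `l` and one alternative. If slot
`n` is not available, the slots are `0, …, l` at one end and `0` at the other; the children of the
word have parameters `1, …, l + 1` and `1`, and there are `(2k + l).choose k` descendants after `k`
steps. If slot `n` is available at both ends, there are two more children, which are again of this
kind, with parameters `l + 1` and `1`, and the number of descendants is
`(2k + l + 1).choose k + (2k + 1).choose k - 2 ^ k`. All words descend from `11`, which is of the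
second kind with `l = 0`; taking `k = n - 1` gives the count.
-/

namespace NonnestingPerm

/-! ### Pattern containment through sublists -/

theorem contains_iff_exists_ofFn_sublist (π σ : List ℕ) :
    Contains π σ ↔ ∃ f : Fin σ.length → ℕ, (List.ofFn f).Sublist π ∧
      ∀ r s, (f r < f s ↔ σ.get r < σ.get s) ∧ (f r = f s ↔ σ.get r = σ.get s) := by
  constructor
  · rintro ⟨i, hi, h⟩
    refine ⟨fun r => π.get (i r), ?_, h⟩
    rw [List.sublist_iff_exists_fin_orderEmbedding_get_eq]
    refine ⟨OrderEmbedding.ofStrictMono (fun j => i (j.cast (by simp))) ?_, ?_⟩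
    · intro a b hab
      exact hi (Fin.lt_def.2 (Fin.lt_def.1 hab))
    · intro j
      rw [List.get_ofFn]
      rfl
  · rintro ⟨f, hf, h⟩
    rw [List.sublist_iff_exists_fin_orderEmbedding_get_eq] at hf
    obtain ⟨e, he⟩ := hf
    have key : ∀ r : Fin σ.length, π.get (e (r.cast (by simp))) = f r := by
      intro r
      rw [← he, List.get_ofFn]
      rfl
    refine ⟨fun r => e (r.cast List.length_ofFn.symm), ?_, ?_⟩
    · intro a b hab
      exact e.strictMono (Fin.lt_def.2 (Fin.lt_def.1 hab))
    · intro r s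
      rw [key, key]
      exact h r s

theorem avoids_four_iff (π : List ℕ) (p q r s : ℕ) :
    Avoids π [p, q, r, s] ↔ ∀ a b c d : ℕ, [a, b, c, d].Sublist π →
      ¬ ∀ i j : Fin 4, (![a, b, c, d] i < ![a, b, c, d] j ↔ ![p, q, r, s] i < ![p, q, r, s] j) ∧
        (![a, b, c, d] i = ![a, b, c, d] j ↔ ![p, q, r, s] i = ![p, q, r, s] j) := by
  have hget : ∀ i : Fin 4, [p, q, r, s].get i = ![p, q, r, s] i := by
    intro i; fin_cases i <;> rfl
  rw [Avoids, contains_iff_exists_ofFn_sublist]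
  constructor
  · rintro h a b c d hs hij
    refine h ⟨(![a, b, c, d] : Fin 4 → ℕ), by simpa using hs, fun i j => ?_⟩
    have := hij i j
    rwa [← hget, ← hget] at this
  · rintro h ⟨f, hs, hij⟩
    have hf : (![f 0, f 1, f 2, f 3] : Fin 4 → ℕ) = f := by
      funext i; fin_cases i <;> rfl
    refine h (f 0) (f 1) (f 2) (f 3) (by simpa [List.ofFn_succ] using hs) fun i j => ?_
    have := hij i j
    rw [hf, ← hget, ← hget]
    exact this

theorem avoids_1221_iff (π : List ℕ) :
    Avoids π [1, 2, 2, 1] ↔ ∀ a b, a < b → ¬ [a, b, b, a].Sublist π := by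
  rw [avoids_four_iff]
  constructor
  · intro h a b hab hs
    apply h a b b a hs
    simp [Fin.forall_fin_succ]; omega
  · intro h a b c d hs hij
    simp [Fin.forall_fin_succ] at hij
    obtain rfl : b = c := by omega
    obtain rfl : a = d := by omega
    exact h a b (by omega) hs

theorem avoids_2112_iff (π : List ℕ) :
    Avoids π [2, 1, 1, 2] ↔ ∀ a b, a < b → ¬ [b, a, a, b].Sublist π := by
  rw [avoids_four_iff]
  constructor
  · intro h a b hab hs
    apply h b a a b hs
    simp [Fin.forall_fin_succ]; omega
  · intro h a b c d hs hij
    simp [Fin.forall_fin_succ] at hij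
    obtain rfl : b = c := by omega
    obtain rfl : a = d := by omega
    exact h b a (by omega) hs

theorem avoids_1322_iff (π : List ℕ) :
    Avoids π [1, 3, 2, 2] ↔ ∀ a b c, a < b → b < c → ¬ [a, c, b, b].Sublist π := by
  rw [avoids_four_iff]
  constructor
  · intro h a b c hab hbc hs
    apply h a c b b hs
    simp [Fin.forall_fin_succ]; omega
  · intro h a b c d hs hij
    simp [Fin.forall_fin_succ] at hij
    obtain rfl : c = d := by omega
    exact h a c b (by omega) (by omega) hs

theorem avoids_2231_iff (π : List ℕ) :
    Avoids π [2, 2, 3, 1] ↔ ∀ a b c, a < b → b < c → ¬ [b, b, c, a].Sublist π := by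
  rw [avoids_four_iff]
  constructor
  · intro h a b c hab hbc hs
    apply h b b c a hs
    simp [Fin.forall_fin_succ]; omega
  · intro h a b c d hs hij
    simp [Fin.forall_fin_succ] at hij
    obtain rfl : a = b := by omega
    exact h d a c (by omega) (by omega) hs

/-! ### Good words -/

/-- The words to be counted, with every pattern condition expressed through four-letter
subsequences. The nonnesting condition treats `1221` and `2112` at once. -/
structure Good (n : ℕ) (w : List ℕ) : Prop where
  count_eq : ∀ a, w.count a = if 1 ≤ a ∧ a ≤ n then 2 else 0
  nonnesting : ∀ a b, a ≠ b → ¬ [a, b, b, a].Sublist w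
  avoids_1322 : ∀ a b c, a < b → b < c → ¬ [a, c, b, b].Sublist w
  avoids_2231 : ∀ a b c, a < b → b < c → ¬ [b, b, c, a].Sublist w

theorem coe_eq_doubled_iff (n : ℕ) (w : List ℕ) :
    (w : Multiset ℕ) = doubled n ↔ ∀ a, w.count a = if 1 ≤ a ∧ a ≤ n then 2 else 0 := by
  rw [Multiset.ext]
  refine forall_congr' fun a => ?_
  rw [doubled, Multiset.count_nsmul, Multiset.count_eq_of_nodup (Finset.nodup _),
    Multiset.coe_count]
  simp only [Finset.mem_val, Finset.mem_Icc]
  split_ifs <;> simp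

theorem mem_nonnestingAvoiding_iff (n : ℕ) (w : List ℕ) :
    w ∈ nonnestingAvoiding n {[1, 3, 2, 2], [2, 2, 3, 1]} ↔ Good n w := by
  simp only [nonnestingAvoiding, nonnesting, Set.mem_ofPred_eq, coe_eq_doubled_iff,
    Set.mem_insert_iff, Set.mem_singleton_iff, forall_eq_or_imp, forall_eq, avoids_1221_iff,
    avoids_2112_iff, avoids_1322_iff, avoids_2231_iff]
  constructor
  · rintro ⟨⟨h, h1, h2⟩, h3, h4⟩
    refine ⟨h, fun a b hab => ?_, h3, h4⟩
    rcases lt_or_gt_of_ne hab with hlt | hlt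
    · exact h1 a b hlt
    · exact h2 b a hlt
  · rintro ⟨h, h1, h3, h4⟩
    exact ⟨⟨h, fun a b hab => h1 a b hab.ne, fun a b hab => h1 b a hab.ne'⟩, h3, h4⟩

namespace Good

variable {n : ℕ} {w : List ℕ}

theorem mem_iff (h : Good n w) {a : ℕ} : a ∈ w ↔ 1 ≤ a ∧ a ≤ n := by
  rw [← List.count_pos_iff, h.count_eq]
  split_ifs with h' <;> simp [h']

theorem count_of_mem (h : Good n w) {a : ℕ} (ha : a ∈ w) : w.count a = 2 := by
  rw [h.count_eq, if_pos (h.mem_iff.1 ha)]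

theorem length_eq (h : Good n w) : w.length = 2 * n := by
  have := (coe_eq_doubled_iff n w).2 h.count_eq
  have h2 := congrArg Multiset.card this
  simpa [doubled] using h2

theorem reverse (h : Good n w) : Good n w.reverse := by
  refine ⟨fun a => by rw [List.count_reverse, h.count_eq], fun a b hab hs => ?_,
    fun a b c hab hbc hs => ?_, fun a b c hab hbc hs => ?_⟩
  · exact h.nonnesting a b hab (by simpa using hs.reverse)
  · exact h.avoids_2231 a b c hab hbc (by simpa using hs.reverse)
  · exact h.avoids_1322 a b c hab hbc (by simpa using hs.reverse)

end Good

theorem Good.filter_ne {n : ℕ} {w : List ℕ} (h : Good (n + 1) w) :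
    Good n (w.filter (· ≠ n + 1)) := by
  have hs : (w.filter (· ≠ n + 1)).Sublist w := List.filter_sublist
  refine ⟨fun a => ?_, fun a b hab h' => h.nonnesting a b hab (h'.trans hs),
    fun a b c hab hbc h' => h.avoids_1322 a b c hab hbc (h'.trans hs),
    fun a b c hab hbc h' => h.avoids_2231 a b c hab hbc (h'.trans hs)⟩
  by_cases ha : a = n + 1
  · subst ha
    rw [List.count_eq_zero_of_not_mem (by simp)]
    simp
  · rw [List.count_filter (by simpa using ha), h.count_eq]
    congr 1
    simp only [eq_iff_iff]
    omega

/-! ### The position of the largest letter -/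

theorem pair_sublist_of_two_le_count {l : List ℕ} {a : ℕ} (h : 2 ≤ l.count a) :
    [a, a].Sublist l :=
  List.replicate_sublist_iff.2 h

/-- The forbidden patterns leave no room for a maximal letter strictly inside the word on both
sides: with outer letters `x < y`, the first `y` lies either after a copy of the maximum, giving
`1322`, or before both copies, giving `2112`. -/
theorem Good.not_lt_of_cons_append {n x y : ℕ} {m : List ℕ} (h : Good (n + 1) (x :: m ++ [y]))
    (hx : x ≠ n + 1) (hy : y ≠ n + 1) : ¬ x < y := by
  intro hxy
  have hyn : y < n + 1 := lt_of_le_of_ne (h.mem_iff.1 (by simp)).2 hy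
  have hN : m.count (n + 1) = 2 := by
    have := h.count_of_mem (a := n + 1) (h.mem_iff.2 (by omega))
    simpa [List.count_cons, hx, hy] using this
  have hcy : m.count y = 1 := by
    have := h.count_of_mem (a := y) (by simp)
    simpa [List.count_cons, hxy.ne] using this
  obtain ⟨p, q, rfl⟩ := List.append_of_mem (List.count_pos_iff.1 (by omega : 0 < m.count y))
  simp only [List.count_append, List.count_cons, beq_iff_eq, hy, if_false] at hN
  rcases Nat.eq_zero_or_pos (p.count (n + 1)) with h0 | h0
  · refine h.nonnesting y (n + 1) hy ?_
    have h1 : [n + 1, n + 1].Sublist q := pair_sublist_of_two_le_count (by omega)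
    have h2 : [y, n + 1, n + 1, y].Sublist ((y :: q) ++ [y]) :=
      (h1.cons_cons y).append (List.Sublist.refl [y])
    exact h2.trans (by simp)
  · refine h.avoids_1322 x y (n + 1) hxy hyn ?_
    have h1 : [n + 1].Sublist p := by simpa using List.count_pos_iff.1 h0
    have h2 : [y, y].Sublist ((y :: q) ++ [y]) := by simp
    simpa using (h1.append h2).cons_cons x

/-- The largest letter of a good word is its first or its last letter. -/
theorem Good.exists_eq_cons_or_reverse {n : ℕ} {w : List ℕ} (h : Good (n + 1) w) :
    (∃ l, w = (n + 1) :: l) ∨ ∃ l, w.reverse = (n + 1) :: l := by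
  have hlen := h.length_eq
  rcases w with _ | ⟨x, l⟩
  · simp at hlen
  rcases l.eq_nil_or_concat with rfl | ⟨m, y, rfl⟩
  · simp at hlen; omega
  rw [List.concat_eq_append] at *
  by_cases hx : x = n + 1
  · exact Or.inl ⟨_, by rw [hx]⟩
  by_cases hy : y = n + 1
  · exact Or.inr ⟨_, by simp [hy]; rfl⟩
  exfalso
  rcases lt_trichotomy x y with hlt | rfl | hlt
  · exact h.not_lt_of_cons_append hx hy (by simpa using hlt)
  · have hN : m.count (n + 1) = 2 := by
      have := h.count_of_mem (a := n + 1) (h.mem_iff.2 (by omega))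
      simpa [List.count_cons, hx, hy] using this
    refine h.nonnesting x (n + 1) hx ?_
    have h1 : [n + 1, n + 1].Sublist m := pair_sublist_of_two_le_count (by omega)
    simpa using (h1.append (List.Sublist.refl [x])).cons_cons x
  · have h' : Good (n + 1) (y :: m.reverse ++ [x]) := by simpa using h.reverse
    exact h'.not_lt_of_cons_append hy hx hlt

/-! ### Insertion of a new largest letter -/

/-- `Admissible u v` says that `u` consists of distinct letters, each exceeding every letter of
`v` that is not in `u`. It is the condition for the two copies of a new largest letter to be put
in front of `u` and between `u` and `v`. -/
def Admissible (u v : List ℕ) : Prop :=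
  u.Nodup ∧ ∀ a ∈ u, ∀ b ∈ v, b ∉ u → b < a

instance (u v : List ℕ) : Decidable (Admissible u v) := by
  unfold Admissible; infer_instance

/-- The positions at which the second copy of `n + 1` may be inserted in `w` when the first copy
is put at the front. No position beyond `n` is admissible in a good word with letters up to `n`. -/
def slots (n : ℕ) (w : List ℕ) : Finset ℕ :=
  (Finset.range (n + 1)).filter fun k => Admissible (w.take k) (w.drop k)

/-- Put one copy of `N` at the front of `w` and another one after the first `k` letters of `w`. -/
def extend (N : ℕ) (w : List ℕ) (k : ℕ) : List ℕ :=
  N :: (w.take k ++ N :: w.drop k)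

theorem admissible_nil (v : List ℕ) : Admissible [] v := by simp [Admissible]

theorem sublist_filter_of_forall {s l : List ℕ} {N : ℕ} (h : s.Sublist l) (hN : ∀ a ∈ s, a ≠ N) :
    s.Sublist (l.filter (· ≠ N)) := by
  have := h.filter (· ≠ N)
  rwa [List.filter_eq_self.2 (by simpa using hN)] at this

theorem filter_ne_cons_append_cons {u v : List ℕ} {N : ℕ} (h : N ∉ u ++ v) :
    (N :: (u ++ N :: v)).filter (· ≠ N) = u ++ v := by
  have h' : ∀ a ∈ u ++ v, a ≠ N := fun a ha e => h (e ▸ ha)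
  have h2 := (List.filter_eq_self (p := (· ≠ N)) (l := u ++ v)).2 (by simpa using h')
  rw [List.filter_cons_of_neg (by simp), List.filter_append, List.filter_cons_of_neg (by simp),
    ← List.filter_append, h2]

theorem cons_sublist_of_cons_sublist_cons {a b : ℕ} {s l : List ℕ} (hab : a ≠ b)
    (h : (a :: s).Sublist (b :: l)) : (a :: s).Sublist l := by
  cases h with
  | cons _ h => exact h
  | cons_cons _ h => exact absurd rfl hab

/-- Splitting a sublist at the only copy of a letter. -/
theorem append_cons_sublist_append_cons {s t u v : List ℕ} {N : ℕ} (hu : N ∉ u) (hv : N ∉ v) :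
    (s ++ N :: t).Sublist (u ++ N :: v) ↔ s.Sublist u ∧ t.Sublist v := by
  constructor
  · intro h
    induction u generalizing s with
    | nil =>
      rcases s with _ | ⟨x, s⟩
      · exact ⟨List.Sublist.refl _, by simpa using h⟩
      · exfalso
        have h1 : (s ++ N :: t).Sublist v := by
          cases h with
          | cons _ h => exact (List.sublist_cons_self _ _).trans h
          | cons_cons _ h => exact h
        exact hv (h1.subset (by simp))
    | cons y u ih =>
      rw [List.mem_cons, not_or] at hu
      rcases s with _ | ⟨x, s⟩
      · exact ⟨List.nil_sublist _,
          (ih (s := []) hu.2 (cons_sublist_of_cons_sublist_cons hu.1 h)).2⟩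
      · cases h with
        | cons _ h => exact ⟨(ih (s := x :: s) hu.2 h).1.cons _, (ih (s := x :: s) hu.2 h).2⟩
        | cons_cons _ h => exact ⟨(ih hu.2 h).1.cons_cons _, (ih hu.2 h).2⟩
  · rintro ⟨h1, h2⟩
    exact h1.append (h2.cons_cons N)

theorem not_pair_sublist {u : List ℕ} (h : u.Nodup) (a : ℕ) : ¬ [a, a].Sublist u :=
  List.nodup_iff_sublist.1 h a

theorem Good.cons_append_cons {n : ℕ} {u v : List ℕ} (h : Good n (u ++ v))
    (ha : Admissible u v) : Good (n + 1) ((n + 1) :: (u ++ (n + 1) :: v)) := by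
  have hN : n + 1 ∉ u ++ v := fun hm => by have := h.mem_iff.1 hm; omega
  have hu : n + 1 ∉ u := fun hm => hN (List.mem_append_left _ hm)
  have hv : n + 1 ∉ v := fun hm => hN (List.mem_append_right _ hm)
  have old : ∀ {s : List ℕ}, s.Sublist ((n + 1) :: (u ++ (n + 1) :: v)) →
      (∀ a ∈ s, a ≠ n + 1) → s.Sublist (u ++ v) := fun hs hs' => by
    have := sublist_filter_of_forall hs hs'
    rwa [filter_ne_cons_append_cons hN] at this
  have hle : ∀ {s : List ℕ}, s.Sublist ((n + 1) :: (u ++ (n + 1) :: v)) → ∀ a ∈ s, a ≤ n + 1 := by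
    intro s hs a has
    have := hs.subset has
    simp only [List.mem_cons, List.mem_append] at this
    have h2 : a ∈ u ++ v → a ≤ n := fun hm => (h.mem_iff.1 hm).2
    rw [List.mem_append] at h2
    rcases this with e | h3 | e | h3
    · exact e.le
    · exact (h2 (Or.inl h3)).trans n.le_succ
    · exact e.le
    · exact (h2 (Or.inr h3)).trans n.le_succ
  refine ⟨fun a => ?_, fun a b hab hs => ?_, fun a b c hab hbc hs => ?_,
    fun a b c hab hbc hs => ?_⟩
  · have hc := h.count_eq a
    rw [List.count_append] at hc
    simp only [List.count_cons, List.count_append, beq_iff_eq]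
    by_cases e : n + 1 = a
    · subst e
      simp [List.count_eq_zero_of_not_mem hu, List.count_eq_zero_of_not_mem hv]
    · simp only [e, if_false, add_zero, hc]
      congr 1
      simp only [eq_iff_iff]
      omega
  · by_cases ea : a = n + 1
    · subst ea
      have h1 : ([b, b] ++ (n + 1) :: []).Sublist (u ++ (n + 1) :: v) := by simpa using hs
      exact not_pair_sublist ha.1 b ((append_cons_sublist_append_cons hu hv).1 h1).1
    by_cases eb : b = n + 1
    · subst eb
      have h1 : ([a] ++ (n + 1) :: [n + 1, a]).Sublist (u ++ (n + 1) :: v) := by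
        simpa using cons_sublist_of_cons_sublist_cons ea hs
      exact hv (((append_cons_sublist_append_cons hu hv).1 h1).2.subset (by simp))
    · exact h.nonnesting a b hab (old hs (by simp [ea, eb]))
  · have hcn := hle hs c (by simp)
    by_cases ec : c = n + 1
    · subst ec
      have h1 : ([a] ++ (n + 1) :: [b, b]).Sublist (u ++ (n + 1) :: v) := by
        simpa using cons_sublist_of_cons_sublist_cons (by omega) hs
      obtain ⟨hau, hbv⟩ := (append_cons_sublist_append_cons hu hv).1 h1
      have h2 : 2 ≤ v.count b := List.replicate_sublist_iff.1 hbv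
      have hbm : b ∈ v := hbv.subset (by simp)
      have h3 := h.count_of_mem (List.mem_append_right u hbm)
      rw [List.count_append] at h3
      have := ha.2 a (hau.subset (by simp)) b hbm (List.count_eq_zero.1 (by omega))
      omega
    · exact h.avoids_1322 a b c hab hbc (old hs (by simp; omega))
  · have hcn := hle hs c (by simp)
    by_cases ec : c = n + 1
    · subst ec
      have h1 : ([b, b] ++ (n + 1) :: [a]).Sublist (u ++ (n + 1) :: v) := by
        simpa using cons_sublist_of_cons_sublist_cons (by omega) hs
      exact not_pair_sublist ha.1 b ((append_cons_sublist_append_cons hu hv).1 h1).1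
    · exact h.avoids_2231 a b c hab hbc (old hs (by simp; omega))

theorem Good.admissible_of_cons {n : ℕ} {u v : List ℕ}
    (h : Good (n + 1) ((n + 1) :: (u ++ (n + 1) :: v))) : Admissible u v := by
  have hN := h.count_of_mem (a := n + 1) (by simp)
  simp only [List.count_cons, List.count_append, beq_self_eq_true, if_true] at hN
  have hu : n + 1 ∉ u := List.count_eq_zero.1 (by omega)
  refine ⟨List.nodup_iff_sublist.2 fun a hs => ?_, fun a hau b hbv hbu => ?_⟩
  · have ha : a ≠ n + 1 := fun e => hu (hs.subset (by simp [e]))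
    refine h.nonnesting (n + 1) a ha.symm ?_
    have : ([a, a] ++ [n + 1]).Sublist (u ++ (n + 1) :: v) := hs.append (by simp)
    exact this.cons_cons _
  · have hb := h.count_of_mem (a := b) (by simp [hbv])
    have hbN : b ≠ n + 1 := fun e => by
      subst e
      have := List.count_pos_iff.2 hbv
      omega
    have hb0 := List.count_eq_zero.2 hbu
    simp only [List.count_cons, List.count_append, beq_iff_eq, hbN.symm, if_false, hb0] at hb
    by_contra hlt
    have hab : a ≠ b := fun e => hbu (e ▸ hau)
    have hbn := (h.mem_iff (a := b)).1 (by simp [hbv])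
    refine h.avoids_1322 a b (n + 1) (by omega) (by omega) ?_
    have h1 : [b, b].Sublist v := pair_sublist_of_two_le_count (by omega)
    have h2 : [a].Sublist u := by simpa using hau
    exact ((h2.append (h1.cons_cons (n + 1)))).cons _

theorem Good.length_le_of_nodup {n : ℕ} {w u : List ℕ} (h : Good n w) (hu : u.Nodup)
    (hs : u ⊆ w) : u.length ≤ n := by
  rw [← List.toFinset_card_of_nodup hu]
  have : u.toFinset ⊆ Finset.Icc 1 n := fun a ha => by
    rw [Finset.mem_Icc]
    exact h.mem_iff.1 (hs (List.mem_toFinset.1 ha))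
  simpa using Finset.card_le_card this

/-! ### Slots after an insertion -/

theorem zero_mem_slots (n : ℕ) (w : List ℕ) : 0 ∈ slots n w := by
  simp [slots, admissible_nil]

theorem mem_slots {n k : ℕ} {w : List ℕ} :
    k ∈ slots n w ↔ k ≤ n ∧ Admissible (w.take k) (w.drop k) := by
  simp [slots]

theorem Good.extend {n k : ℕ} {w : List ℕ} (h : Good n w) (hk : k ∈ slots n w) :
    Good (n + 1) (extend (n + 1) w k) :=
  Good.cons_append_cons (by simpa using h) (mem_slots.1 hk).2

theorem Good.filter_extend {n : ℕ} {w : List ℕ} (h : Good n w) (k : ℕ) :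
    (NonnestingPerm.extend (n + 1) w k).filter (· ≠ n + 1) = w := by
  have hN : n + 1 ∉ w := fun hm => by have := h.mem_iff.1 hm; omega
  rw [NonnestingPerm.extend, filter_ne_cons_append_cons (by simpa using hN),
    List.take_append_drop]

/-- Every good word that starts with its largest letter extends a smaller good word. -/
theorem Good.exists_extend_eq {n : ℕ} {l : List ℕ} (h : Good (n + 1) ((n + 1) :: l)) :
    ∃ w k, Good n w ∧ k ∈ slots n w ∧ NonnestingPerm.extend (n + 1) w k = (n + 1) :: l := by
  have hN := h.count_of_mem (a := n + 1) (by simp)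
  simp only [List.count_cons, beq_self_eq_true, if_true] at hN
  obtain ⟨u, v, rfl⟩ := List.append_of_mem (List.count_pos_iff.1 (by omega : 0 < l.count (n + 1)))
  simp only [List.count_cons, List.count_append, beq_self_eq_true, if_true] at hN
  have hN' : n + 1 ∉ u ++ v := by
    rw [← List.count_eq_zero, List.count_append]; omega
  have hg : Good n (u ++ v) := by
    have := h.filter_ne
    rwa [filter_ne_cons_append_cons hN'] at this
  have ha := h.admissible_of_cons
  refine ⟨u ++ v, u.length, hg, mem_slots.2 ⟨?_, by simpa using ha⟩, by
    simp [NonnestingPerm.extend]⟩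
  exact hg.length_le_of_nodup ha.1 (List.subset_append_left _ _)

/-- The admissible insertions after an insertion at the front. -/
theorem Good.mem_slots_extend {n k j : ℕ} {w : List ℕ} (h : Good n w) (hk : k ∈ slots n w) :
    j + 1 ∈ slots (n + 1) (NonnestingPerm.extend (n + 1) w k) ↔ j ≤ k ∧ j ∈ slots n w := by
  have hN : ∀ b ∈ w, b < n + 1 := fun b hm => by have := h.mem_iff.1 hm; omega
  have hkn := (mem_slots.1 hk).1
  have hlen := h.length_eq
  have hkl : (w.take k).length = k := by simp; omega
  rw [mem_slots, mem_slots, NonnestingPerm.extend, List.take_succ_cons, List.drop_succ_cons]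
  rcases Nat.lt_or_ge k j with hjk | hjk
  · constructor
    · rintro ⟨-, hnd, -⟩
      exfalso
      rw [List.nodup_cons] at hnd
      apply hnd.1
      obtain ⟨i, rfl⟩ : ∃ i, j = k + (i + 1) := ⟨j - k - 1, by omega⟩
      have e : k + (i + 1) = (w.take k).length + (i + 1) := by rw [hkl]
      rw [e, List.take_length_add_append]
      simp
    · rintro ⟨h', -⟩
      omega
  · have hd : w.drop j = (w.take k).drop j ++ w.drop k := by
      conv_lhs => rw [← List.take_append_drop k w]
      rw [List.drop_append_of_le_length (by omega)]
    have ht : w.take j = (w.take k).take j := by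
      rw [List.take_take, min_eq_left hjk]
    rw [List.take_append_of_le_length (by omega), List.drop_append_of_le_length (by omega), hd,
      ht]
    have hN1 : ∀ b ∈ (w.take k).take j, b < n + 1 := fun b hb =>
      hN b (List.mem_of_mem_take (List.mem_of_mem_take hb))
    have hN2 : ∀ b ∈ (w.take k).drop j, b < n + 1 := fun b hb =>
      hN b (List.mem_of_mem_take (List.mem_of_mem_drop hb))
    have hN3 : ∀ b ∈ w.drop k, b < n + 1 := fun b hb => hN b (List.mem_of_mem_drop hb)
    generalize (w.take k).take j = p at *
    generalize (w.take k).drop j = q at *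
    generalize w.drop k = v at *
    have hNp : n + 1 ∉ p := fun hm => (hN1 _ hm).false
    constructor
    · rintro ⟨-, hnd, hlt⟩
      refine ⟨hjk, by omega, (List.nodup_cons.1 hnd).2, fun a ha b hb hbp => ?_⟩
      have hbN : b ≠ n + 1 := by
        rcases List.mem_append.1 hb with hb | hb
        · exact (hN2 b hb).ne
        · exact (hN3 b hb).ne
      refine hlt a (List.mem_cons_of_mem _ ha) b ?_ (by simp [hbN, hbp])
      simp only [List.mem_append, List.mem_cons] at hb ⊢
      tauto
    · rintro ⟨-, -, hnd, hlt⟩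
      refine ⟨by omega, List.nodup_cons.2 ⟨hNp, hnd⟩, fun a ha b hb hbp => ?_⟩
      rw [List.mem_cons, not_or] at hbp
      have hb' : b ∈ q ++ v := by
        simp only [List.mem_append, List.mem_cons] at hb ⊢
        tauto
      rcases List.mem_cons.1 ha with rfl | ha
      · rcases List.mem_append.1 hb' with hb | hb
        · exact hN2 b hb
        · exact hN3 b hb
      · exact hlt a ha b hb' hbp.2

/-- After an insertion at the front, the next letter can be inserted at the back only with its two
copies together, unless in the word obtained all first copies precede all second copies. In that
case its first copy may also go between the two halves of the word. -/
theorem Good.slots_reverse_extend {n k : ℕ} {w : List ℕ} (h : Good n w) (hk : k ∈ slots n w)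
    (hn : 1 ≤ n) :
    slots (n + 1) (NonnestingPerm.extend (n + 1) w k).reverse =
      if k = n then {0, n + 1} else {0} := by
  have hN : ∀ b ∈ w, b < n + 1 := fun b hm => by have := h.mem_iff.1 hm; omega
  obtain ⟨hkn, hadm⟩ := mem_slots.1 hk
  have hlen := h.length_eq
  have hrev : (NonnestingPerm.extend (n + 1) w k).reverse =
      (w.drop k).reverse ++ (n + 1) :: ((w.take k).reverse ++ [n + 1]) := by
    simp [NonnestingPerm.extend]
  have hvl : (w.drop k).length = 2 * n - k := by rw [List.length_drop, hlen]
  -- A nonempty prefix has to reach the second copy of the largest letter, so it contains all of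
  -- `w.drop k`, which must then have distinct letters.
  have key : ∀ j, 1 ≤ j → j ∈ slots (n + 1) (NonnestingPerm.extend (n + 1) w k).reverse →
      k = n ∧ j = n + 1 := by
    intro j hj hmem
    rw [hrev, mem_slots] at hmem
    obtain ⟨hjn, hnd, hlt⟩ := hmem
    rcases Nat.lt_or_ge (2 * n - k) j with hjk | hjk
    · have hv : (w.drop k).Nodup := by
        rw [← List.nodup_reverse]
        obtain ⟨i, rfl⟩ : ∃ i, j = (w.drop k).reverse.length + i :=
          ⟨j - (2 * n - k), by rw [List.length_reverse, hvl]; omega⟩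
        rw [List.take_length_add_append] at hnd
        exact hnd.sublist (List.sublist_append_left _ _)
      have := h.length_le_of_nodup hv (List.drop_subset _ _)
      omega
    · exfalso
      have hle : j ≤ (w.drop k).reverse.length := by rw [List.length_reverse, hvl]; omega
      rw [List.take_append_of_le_length hle, List.drop_append_of_le_length hle] at hlt
      have hpos : 0 < ((w.drop k).reverse.take j).length := by
        rw [List.length_take]; omega
      obtain ⟨a, ha⟩ := List.exists_mem_of_length_pos hpos
      have haN : ∀ a ∈ (w.drop k).reverse.take j, a < n + 1 := fun a ha =>
        hN a (List.mem_of_mem_drop (List.mem_reverse.1 (List.mem_of_mem_take ha)))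
      have := hlt a ha (n + 1) (by simp) (fun hm => (haN _ hm).false)
      exact absurd (haN a ha) (by omega)
  have hfull : k = n → n + 1 ∈ slots (n + 1) (NonnestingPerm.extend (n + 1) w k).reverse := by
    intro e
    subst e
    have hcount : ∀ a ∈ w, (w.take k).count a = 1 ∧ (w.drop k).count a = 1 := by
      -- The prefix consists of `k` distinct letters among `k` available ones, so of all of them.
      intro a ha
      have hsub : (w.take k).toFinset ⊆ Finset.Icc 1 k := fun b hb => by
        rw [Finset.mem_Icc]
        exact h.mem_iff.1 (List.mem_of_mem_take (List.mem_toFinset.1 hb))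
      have heq := Finset.eq_of_subset_of_card_le hsub (by
        rw [List.toFinset_card_of_nodup hadm.1, List.length_take]; simp; omega)
      have hat : a ∈ w.take k := by
        rw [← List.mem_toFinset, heq, Finset.mem_Icc]
        exact h.mem_iff.1 ha
      have h1 := List.count_eq_one_of_mem hadm.1 hat
      have h2 := h.count_of_mem ha
      rw [← List.take_append_drop k w, List.count_append] at h2
      omega
    have hNv : k + 1 ∉ w.drop k := fun hm => (hN _ (List.mem_of_mem_drop hm)).false
    have hvnd : (w.drop k).Nodup := List.nodup_iff_count_le_one.2 fun a => by
      by_cases ha : a ∈ w.drop k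
      · exact (hcount a (List.mem_of_mem_drop ha)).2.le
      · simp [List.count_eq_zero_of_not_mem ha]
    have hl : (w.drop k).reverse.length = k := by rw [List.length_reverse, hvl]; omega
    have e : k + 1 = (w.drop k).reverse.length + 1 := by rw [hl]
    rw [mem_slots, hrev]
    rw [e, List.take_length_add_append, List.drop_length_add_append, ← e]
    refine ⟨le_rfl, ?_, fun a _ b hb hb' => ?_⟩
    · simp [List.nodup_append, hvnd]
      rintro a ha rfl
      exact hNv ha
    · exfalso
      simp only [List.take_succ_cons, List.take_zero, List.drop_succ_cons, List.drop_zero,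
        List.mem_append, List.mem_reverse, List.mem_singleton, not_or] at hb hb'
      rcases hb with hb | hb
      · have := (hcount b (List.mem_of_mem_take hb)).2
        exact hb'.1 (List.count_pos_iff.1 (by omega))
      · exact hb'.2 hb
  ext j
  rcases Nat.eq_zero_or_pos j with rfl | hj
  · split_ifs <;> simp [zero_mem_slots]
  · have hj0 : j ≠ 0 := by omega
    constructor
    · intro hm
      obtain ⟨h1, h2⟩ := key j hj hm
      simp [h1, h2]
    · intro hm
      split_ifs at hm with e
      · obtain rfl : j = n + 1 := by simpa [hj0] using hm
        exact hfull e
      · simp [hj0] at hm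

/-! ### The generating tree -/

/-- The good words obtained from `w`, a good word with letters up to `n`, by adding two copies of
`n + 1`, one of them at the front or at the back. -/
def children (n : ℕ) (w : List ℕ) : Finset (List ℕ) :=
  (slots n w).image (extend (n + 1) w) ∪
    (slots n w.reverse).image fun j => (extend (n + 1) w.reverse j).reverse

/-- The good words with letters up to `m + 1`, generated by successive insertions. -/
def words : ℕ → Finset (List ℕ)
  | 0 => {[1, 1]}
  | m + 1 => (words m).biUnion (children (m + 1))

/-- The number of words reached from `w`, a good word with letters up to `n`, by `k` successive
insertions. -/
def descendants : ℕ → ℕ → List ℕ → ℕ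
  | 0, _, _ => 1
  | k + 1, n, w => ∑ j ∈ slots n w, descendants k (n + 1) (extend (n + 1) w j) +
      ∑ j ∈ slots n w.reverse, descendants k (n + 1) (extend (n + 1) w.reverse j).reverse

theorem descendants_reverse (k n : ℕ) (w : List ℕ) :
    descendants k n w.reverse = descendants k n w := by
  induction k generalizing n w with
  | zero => rfl
  | succ k ih => simp only [descendants, List.reverse_reverse, ih, add_comm]

theorem descendants_succ (k n : ℕ) (w : List ℕ) :
    descendants (k + 1) n w = ∑ j ∈ slots n w, descendants k (n + 1) (extend (n + 1) w j) +
      ∑ j ∈ slots n w.reverse, descendants k (n + 1) (extend (n + 1) w.reverse j) := by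
  simp only [descendants, descendants_reverse]

theorem Good.mem_children_iff {n : ℕ} {w c : List ℕ} (h : Good n w) :
    c ∈ children n w ↔ Good (n + 1) c ∧ c.filter (· ≠ n + 1) = w := by
  constructor
  · intro hc
    rw [children, Finset.mem_union, Finset.mem_image, Finset.mem_image] at hc
    rcases hc with ⟨j, hj, rfl⟩ | ⟨j, hj, rfl⟩
    · exact ⟨h.extend hj, h.filter_extend j⟩
    · refine ⟨(h.reverse.extend hj).reverse, ?_⟩
      rw [List.filter_reverse, h.reverse.filter_extend, List.reverse_reverse]
  · rintro ⟨hc, rfl⟩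
    rw [children, Finset.mem_union, Finset.mem_image, Finset.mem_image]
    rcases hc.exists_eq_cons_or_reverse with ⟨l, rfl⟩ | ⟨l, hl⟩
    · obtain ⟨w, k, hw, hk, he⟩ := hc.exists_extend_eq
      left
      rw [← he, hw.filter_extend]
      exact ⟨k, hk, rfl⟩
    · have hc' := hc.reverse
      rw [hl] at hc'
      obtain ⟨w, k, hw, hk, he⟩ := hc'.exists_extend_eq
      have hcr : c = (NonnestingPerm.extend (n + 1) w k).reverse := by
        rw [he, ← hl, List.reverse_reverse]
      right
      rw [hcr, List.filter_reverse, hw.filter_extend, List.reverse_reverse]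
      exact ⟨k, hk, rfl⟩

theorem good_one_iff (w : List ℕ) : Good 1 w ↔ w = [1, 1] := by
  constructor
  · intro h
    rw [show [1, 1] = List.replicate 2 1 from rfl, List.eq_replicate_iff]
    exact ⟨h.length_eq, fun b hb => by have := h.mem_iff.1 hb; omega⟩
  · rintro rfl
    refine ⟨fun a => ?_, fun a b hab hs => ?_, fun a b c hab hbc hs => ?_,
      fun a b c hab hbc hs => ?_⟩
    · simp only [List.count_cons, List.count_nil, beq_iff_eq]
      split_ifs <;> omega
    all_goals exact absurd hs.length_le (by simp)

theorem mem_words_iff (m : ℕ) (w : List ℕ) : w ∈ words m ↔ Good (m + 1) w := by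
  induction m generalizing w with
  | zero => simp [words, good_one_iff]
  | succ m ih =>
    rw [words, Finset.mem_biUnion]
    constructor
    · rintro ⟨v, hv, hw⟩
      exact (((ih v).1 hv).mem_children_iff.1 hw).1
    · intro hw
      exact ⟨_, (ih _).2 hw.filter_ne, hw.filter_ne.mem_children_iff.2 ⟨hw, rfl⟩⟩

theorem Good.extend_injOn {n : ℕ} {w : List ℕ} (h : Good n w) :
    Set.InjOn (NonnestingPerm.extend (n + 1) w) (slots n w) := by
  have hN : n + 1 ∉ w := fun hm => by have := h.mem_iff.1 hm; omega
  have key : ∀ k ∈ slots n w, (NonnestingPerm.extend (n + 1) w k).tail.idxOf (n + 1) = k := by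
    intro k hk
    have hk' := (mem_slots.1 hk).1
    have hlen := h.length_eq
    rw [NonnestingPerm.extend, List.tail_cons,
      List.idxOf_append_of_notMem (fun hm => hN (List.mem_of_mem_take hm)), List.idxOf_cons_self,
      List.length_take]
    omega
  intro i hi j hj hij
  rw [← key i hi, ← key j hj, hij]

theorem Good.disjoint_extend {n : ℕ} {w : List ℕ} (h : Good n w) (hn : 1 ≤ n) :
    Disjoint ((slots n w).image (NonnestingPerm.extend (n + 1) w))
      ((slots n w.reverse).image fun j => (NonnestingPerm.extend (n + 1) w.reverse j).reverse) := by
  rw [Finset.disjoint_left]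
  intro c hc hc'
  obtain ⟨i, hi, rfl⟩ := Finset.mem_image.1 hc
  obtain ⟨j, hj, he⟩ := Finset.mem_image.1 hc'
  have hi' := (mem_slots.1 hi).1
  have hlen := h.length_eq
  -- The last letter of a front insertion belongs to the old word.
  rcases (w.drop i).eq_nil_or_concat with hnil | ⟨m, y, hy⟩
  · rw [List.drop_eq_nil_iff] at hnil
    omega
  · have hl := congrArg List.getLast? he
    have hyw : y ∈ w := List.mem_of_mem_drop (i := i) (by simp [hy])
    have hyn := h.mem_iff.1 hyw
    simp [NonnestingPerm.extend, hy, List.getLast?_cons] at hl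
    omega

theorem Good.sum_children {n : ℕ} {w : List ℕ} (h : Good n w) (hn : 1 ≤ n) (f : List ℕ → ℕ) :
    ∑ c ∈ children n w, f c = ∑ j ∈ slots n w, f (NonnestingPerm.extend (n + 1) w j) +
      ∑ j ∈ slots n w.reverse, f (NonnestingPerm.extend (n + 1) w.reverse j).reverse := by
  rw [children, Finset.sum_union (h.disjoint_extend hn), Finset.sum_image h.extend_injOn,
    Finset.sum_image fun i hi j hj hij =>
      h.reverse.extend_injOn hi hj (List.reverse_injective hij)]

theorem sum_words_descendants (k m : ℕ) :
    ∑ w ∈ words m, descendants k (m + 1) w = (words (m + k)).card := by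
  induction k generalizing m with
  | zero => simp [descendants]
  | succ k ih =>
    rw [show m + (k + 1) = m + 1 + k by omega, ← ih, words, Finset.sum_biUnion]
    · refine Finset.sum_congr rfl fun w hw => ?_
      rw [((mem_words_iff m w).1 hw).sum_children (by omega), descendants]
    · intro v hv w hw hvw
      rw [Function.onFun, Finset.disjoint_left]
      intro c hc hc'
      have h1 := (((mem_words_iff m v).1 hv).mem_children_iff.1 hc).2
      have h2 := (((mem_words_iff m w).1 hw).mem_children_iff.1 hc').2
      exact hvw (h1.symm.trans h2)

/-! ### Counting descendants -/

theorem sum_choose_add_choose (k l : ℕ) :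
    ∑ j ∈ Finset.range (l + 1), (2 * k + (j + 1)).choose k + (2 * k + 1).choose k =
      (2 * (k + 1) + l).choose (k + 1) := by
  induction l with
  | zero =>
    rw [Finset.sum_range_one, show 2 * (k + 1) + 0 = 2 * k + 1 + 1 by ring, Nat.choose_succ_succ,
      Nat.choose_symm_half]
  | succ l ih =>
    rw [Finset.sum_range_succ, add_right_comm, ih,
      show 2 * (k + 1) + (l + 1) = (2 * (k + 1) + l) + 1 by ring, Nat.choose_succ_succ, add_comm,
      show 2 * k + (l + 1 + 1) = 2 * (k + 1) + l by ring]

theorem slots_eq_of_succ_mem_iff {n : ℕ} {w : List ℕ} {s : Finset ℕ} (h0 : 0 ∈ s)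
    (h : ∀ i, i + 1 ∈ slots n w ↔ i + 1 ∈ s) : slots n w = s := by
  ext (_ | i)
  · simp [zero_mem_slots, h0]
  · exact h i

/-- The descendants of a word in which some second copy precedes some first copy, when the last
insertion was at the front (or the word has only one letter). -/
theorem Good.descendants_of_slots_eq_range (k : ℕ) {n l : ℕ} {w : List ℕ} (h : Good n w)
    (hl : l < n) (hs : slots n w = Finset.range (l + 1)) (hr : slots n w.reverse = {0}) :
    descendants k n w = (2 * k + l).choose k := by
  induction k generalizing n l w with
  | zero => simp [descendants]
  | succ k ih =>
    rw [descendants_succ, hs, hr, Finset.sum_singleton, ← sum_choose_add_choose]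
    congr 1
    · refine Finset.sum_congr rfl fun j hj => ?_
      have hjs : j ∈ slots n w := by rwa [hs]
      rw [Finset.mem_range] at hj
      refine ih (h.extend hjs) (by omega) (slots_eq_of_succ_mem_iff (by simp) fun i => ?_) ?_
      · rw [h.mem_slots_extend hjs, hs, Finset.mem_range, Finset.mem_range]
        omega
      · rw [h.slots_reverse_extend hjs (by omega), if_neg (by omega)]
    · have h0 := zero_mem_slots n w.reverse
      refine ih (h.reverse.extend h0) (by omega) (slots_eq_of_succ_mem_iff (by simp) fun i => ?_) ?_
      · rw [h.reverse.mem_slots_extend h0, hr, Finset.mem_singleton, Finset.mem_range]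
        omega
      · rw [h.reverse.slots_reverse_extend h0 (by omega), if_neg (by omega)]

/-- The descendants of a word in which all first copies precede all second copies, when the last
insertion was at the front (or the word has only one letter). -/
theorem Good.descendants_of_slots_eq_insert (k : ℕ) {n l : ℕ} {w : List ℕ} (h : Good n w)
    (hl : l < n) (hs : slots n w = insert n (Finset.range (l + 1)))
    (hr : slots n w.reverse = {0, n}) :
    descendants k n w + 2 ^ k = (2 * k + l + 1).choose k + (2 * k + 1).choose k := by
  induction k generalizing n l w with
  | zero => simp [descendants]
  | succ k ih =>
    have hn : n ∈ slots n w := by simp [hs]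
    have hn' : n ∈ slots n w.reverse := by simp [hr]
    have h0 := zero_mem_slots n w.reverse
    have e1 : ∀ j ∈ Finset.range (l + 1), descendants k (n + 1)
        (NonnestingPerm.extend (n + 1) w j) = (2 * k + (j + 1)).choose k := fun j hj => by
      have hjs : j ∈ slots n w := by rw [hs]; exact Finset.mem_insert_of_mem hj
      rw [Finset.mem_range] at hj
      refine (h.extend hjs).descendants_of_slots_eq_range k (by omega)
        (slots_eq_of_succ_mem_iff (by simp) fun i => ?_) ?_
      · rw [h.mem_slots_extend hjs, hs, Finset.mem_insert, Finset.mem_range, Finset.mem_range]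
        omega
      · rw [h.slots_reverse_extend hjs (by omega), if_neg (by omega)]
    have e2 : descendants k (n + 1) (NonnestingPerm.extend (n + 1) w.reverse 0) =
        (2 * k + 1).choose k := by
      refine (h.reverse.extend h0).descendants_of_slots_eq_range k (by omega)
        (slots_eq_of_succ_mem_iff (by simp) fun i => ?_) ?_
      · rw [h.reverse.mem_slots_extend h0, hr, Finset.mem_insert, Finset.mem_singleton,
          Finset.mem_range]
        omega
      · rw [h.reverse.slots_reverse_extend h0 (by omega), if_neg (by omega)]
    have e3 := ih (l := l + 1) (h.extend hn) (by omega)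
      (slots_eq_of_succ_mem_iff (by simp) fun i => by
        rw [h.mem_slots_extend hn, hs, Finset.mem_insert, Finset.mem_insert, Finset.mem_range,
          Finset.mem_range]
        omega)
      (by rw [h.slots_reverse_extend hn (by omega), if_pos rfl])
    have e4 := ih (l := 1) (h.reverse.extend hn') (by omega)
      (slots_eq_of_succ_mem_iff (by simp) fun i => by
        rw [h.reverse.mem_slots_extend hn', hr, Finset.mem_insert, Finset.mem_insert,
          Finset.mem_singleton, Finset.mem_range]
        omega)
      (by rw [h.reverse.slots_reverse_extend hn' (by omega), if_pos rfl])
    rw [descendants_succ, hs, hr, Finset.sum_insert (by simp; omega),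
      Finset.sum_pair (by omega), Finset.sum_congr rfl e1, e2]
    have e5 := sum_choose_add_choose k l
    have e6 : (2 * (k + 1) + l + 1).choose (k + 1) =
        (2 * k + (l + 1) + 1).choose k + (2 * (k + 1) + l).choose (k + 1) := by
      rw [Nat.choose_succ_succ, show 2 * k + (l + 1) + 1 = 2 * (k + 1) + l by ring]
    have e7 : (2 * (k + 1) + 1).choose (k + 1) =
        (2 * k + 1 + 1).choose k + 2 * (2 * k + 1).choose k := by
      rw [Nat.choose_succ_succ, show 2 * (k + 1) = 2 * k + 1 + 1 by ring,
        Nat.choose_succ_succ (2 * k + 1) k, Nat.choose_symm_half, two_mul ((2 * k + 1).choose k)]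
    rw [pow_succ]
    omega

theorem card_words (m : ℕ) : (words m).card + 2 ^ m = (2 * (m + 1)).choose (m + 1) := by
  have h1 : Good 1 [1, 1] := (good_one_iff _).2 rfl
  have hs : slots 1 [1, 1] = {0, 1} := by decide
  have h2 := h1.descendants_of_slots_eq_insert m (l := 0) (by omega)
    (by rw [hs]; decide) (by simpa using hs)
  have h3 := sum_words_descendants m 0
  simp only [words, Finset.sum_singleton, zero_add] at h3
  rw [← h3, h2, show 2 * (m + 1) = 2 * m + 1 + 1 by ring, Nat.choose_succ_succ,
    Nat.choose_symm_half, add_zero]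

end NonnestingPerm

theorem theorem1322 (n : ℕ) (hn : 1 ≤ n) :
    (NonnestingPerm.nonnestingAvoiding n {[1, 3, 2, 2], [2, 2, 3, 1]}).Finite ∧
    ((NonnestingPerm.nonnestingAvoiding n {[1, 3, 2, 2], [2, 2, 3, 1]}).ncard : ℤ) =
      ((2 * n).choose n : ℤ) - 2 ^ (n - 1) := by
  obtain ⟨m, rfl⟩ : ∃ m, n = m + 1 := ⟨n - 1, by omega⟩
  have hset : NonnestingPerm.nonnestingAvoiding (m + 1) {[1, 3, 2, 2], [2, 2, 3, 1]} =
      (NonnestingPerm.words m : Set (List ℕ)) := by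
    ext w
    rw [NonnestingPerm.mem_nonnestingAvoiding_iff, Finset.mem_coe, NonnestingPerm.mem_words_iff]
  rw [hset]
  refine ⟨Finset.finite_toSet _, ?_⟩
  rw [Set.ncard_coe_finset, ← NonnestingPerm.card_words m]
  push_cast
  simp
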